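/- Let $\mathbb E$ be a real Banach space (not necessarily separable), let $\mathfrak C(\mathbb E)$ be the set of nonempty closed bounded subsets of $\mathbb E$ with the Pompeiu--Hausdorff metric $h$ and its Borel $\sigma$-algebra, and let $\mathfrak C_c(\mathbb E)$ be the set of convex members of $\mathfrak C(\mathbb E)$. Let $(\Omega,\mathscr A,P)$ be a complete probability space without atoms (every measurable set of positive probability has a measurable subset of strictly smaller positive probability). A map from $\Omega$ into a metric space is called countably-valued if it is constant on each piece of some countable partition of $\Omega$ into measurable sets, and strongly measurable if there are countably-valued maps $G_n$ whose distance to it tends to $0$ in the essential supremum over $\Omega$. A random set is a strongly measurable map $F:\Omega\to\mathfrak C(\mathbb E)$ with $\int_\Omega \sup_{x\in F(\omega)}\|x\|\,dP(\omega)<\infty$. Its expectation is the closed Aumann integral $$E(F)=\overline{\Big\{\int_\Omega f\,dP \;:\; f:\Omega\to\mathbb E \text{ strongly measurable},\ f(\omega)\in F(\omega)\text{ for all }\omega\in\Omega\Big\}}.$$ For $X,Y\subset\mathbb E$ nonempty and bounded put $e(X,Y)=\sup_{x\in X}d(x,Y)$. A sequence $(Y_n)$ of nonempty bounded sets converges to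 $Y$ in the sense of Fisher if $e(Y_n,Y)\to0$ and $d(z,Y_n)\to0$ for every $z\in Y$. Let $\mathcal Z\subset\mathfrak C(\mathbb E)$ be compact, and let $(X_n)_{n\ge1}$ be independent identically distributed random sets with $X_n(\omega)\in\mathcal Z$ for all $n$ and $\omega$, and with $E(X_n)=C$ for all $n$, where $C\in\mathfrak C_c(\mathbb E)$. Then, for almost every $\omega\in\Omega$, $$h\Big(\tfrac1n\,\overline{\overline{\mathrm{co}}\,X_1(\omega)+\dots+\overline{\mathrm{co}}\,X_n(\omega)}\,,\;C\Big)\longrightarrow0\qquad(n\to\infty),$$ and, for almost every $\omega\in\Omega$, the sets $$\tfrac1n\,\overline{X_1(\omega)+\dots+X_n(\omega)}$$ converge to $C$ in the sense of Fisher as $n\to\infty$. Here $+$ is the Minkowski sum, the bar is closure, and $\overline{\mathrm{co}}$ is the closed convex hull. -/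

import Mathlib

open Filter Topology MeasureTheory ProbabilityTheory
open scoped Pointwise ENNReal

/-- The space of nonempty closed bounded subsets of `E`. -/
@[ext]
structure BddClosed (E : Type*) [NormedAddCommGroup E] where
  carrier : Set E
  nonempty : carrier.Nonempty
  isClosed : IsClosed carrier
  isBounded : Bornology.IsBounded carrier

namespace BddClosed

variable {E : Type*} [NormedAddCommGroup E]

instance : CoeOut (BddClosed E) (Set E) := ⟨BddClosed.carrier⟩

theorem hausdorffEDist_ne_top (A B : BddClosed E) :
    Metric.hausdorffEDist (A : Set E) (B : Set E) ≠ ⊤ :=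
  Metric.hausdorffEDist_ne_top_of_nonempty_of_bounded A.nonempty B.nonempty
    A.isBounded B.isBounded

/-- The Pompeiu-Hausdorff metric. -/
noncomputable instance : MetricSpace (BddClosed E) where
  dist A B := Metric.hausdorffDist (A : Set E) (B : Set E)
  dist_self A := Metric.hausdorffDist_self_zero
  dist_comm A B := Metric.hausdorffDist_comm
  dist_triangle A B C := Metric.hausdorffDist_triangle (hausdorffEDist_ne_top A B)
  eq_of_dist_eq_zero {A B} h := BddClosed.ext
    ((A.isClosed.hausdorffDist_zero_iff_eq B.isClosed (hausdorffEDist_ne_top A B)).1 h)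

/-- The Borel σ-algebra of the Pompeiu-Hausdorff metric. -/
noncomputable instance : MeasurableSpace (BddClosed E) := borel (BddClosed E)

instance : BorelSpace (BddClosed E) := ⟨rfl⟩

end BddClosed

/-- The measure has no atoms, in the sense that every measurable set of positive measure has a
measurable subset of strictly smaller positive measure. (This is stronger than
`MeasureTheory.NoAtoms`, which only speaks of singletons.) -/
def IsAtomlessMeasure {Ω : Type*} [MeasurableSpace Ω] (P : Measure Ω) : Prop :=
  ∀ s : Set Ω, MeasurableSet s → 0 < P s →
    ∃ t : Set Ω, t ⊆ s ∧ MeasurableSet t ∧ 0 < P t ∧ P t < P s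

/-- A countably-valued map: constant on each piece of a countable measurable partition. -/
def IsCountablyValued {Ω α : Type*} [MeasurableSpace Ω] (G : Ω → α) : Prop :=
  ∃ (a : ℕ → α) (s : ℕ → Set Ω), (∀ i, MeasurableSet (s i)) ∧
    (∀ i j, i ≠ j → Disjoint (s i) (s j)) ∧ (⋃ i, s i) = Set.univ ∧
    ∀ i, ∀ ω ∈ s i, G ω = a i

/-- `F` is the limit, uniformly almost surely, of countably-valued maps. For values in
`BddClosed E` this is strong measurability of `F`; for values in `E` it is measurability in the
sense of Bochner. -/
def IsStronglyMeas {Ω α : Type*} [MeasurableSpace Ω] [PseudoEMetricSpace α]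
    (P : Measure Ω) (F : Ω → α) : Prop :=
  ∃ G : ℕ → Ω → α, (∀ n, IsCountablyValued (G n)) ∧
    Tendsto (fun n => essSup (fun ω => edist (G n ω) (F ω)) P) atTop (𝓝 0)

/-- The norm `‖A‖ = sup {‖x‖ : x ∈ A}` of a set. -/
noncomputable def setENorm {E : Type*} [NormedAddCommGroup E] (A : Set E) : ℝ≥0∞ :=
  ⨆ x ∈ A, ‖x‖ₑ

/-- A random set: a strongly measurable map into `BddClosed E` with integrable norm. -/
def IsRandomSet {Ω E : Type*} [MeasurableSpace Ω] [NormedAddCommGroup E]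
    (P : Measure Ω) (F : Ω → BddClosed E) : Prop :=
  IsStronglyMeas P F ∧ ∫⁻ ω, setENorm (F ω : Set E) ∂P < ⊤

/-- The measurable selectors of `F`. -/
def measurableSelectors {Ω E : Type*} [MeasurableSpace Ω] [NormedAddCommGroup E]
    (P : Measure Ω) (F : Ω → BddClosed E) : Set (Ω → E) :=
  {f | IsStronglyMeas P f ∧ ∀ ω, f ω ∈ (F ω : Set E)}

/-- The expectation of a random set: the (closed) Aumann integral. -/
noncomputable def setExpectation {Ω E : Type*} [MeasurableSpace Ω] [NormedAddCommGroup E]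
    [NormedSpace ℝ E] (P : Measure Ω) (F : Ω → BddClosed E) : Set E :=
  closure ((fun f : Ω → E => ∫ ω, f ω ∂P) '' measurableSelectors P F)

/-- The excess `e(X, Y) = sup {d(x, Y) : x ∈ X}`. -/
noncomputable def excess {E : Type*} [NormedAddCommGroup E] (X Y : Set E) : ℝ≥0∞ :=
  ⨆ x ∈ X, Metric.infEDist x Y

/-- Convergence in the sense of Pompeiu-Hausdorff. -/
def TendstoHausdorff {E : Type*} [NormedAddCommGroup E] (X : ℕ → Set E) (Y : Set E) : Prop :=
  Tendsto (fun n => Metric.hausdorffEDist (X n) Y) atTop (𝓝 0)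

/-- Convergence in the sense of Fisher. -/
def TendstoFisher {E : Type*} [NormedAddCommGroup E] (X : ℕ → Set E) (Y : Set E) : Prop :=
  Tendsto (fun n => excess (X n) Y) atTop (𝓝 0) ∧
    ∀ z ∈ Y, Tendsto (fun n => Metric.infEDist z (X n)) atTop (𝓝 0)

/-- The closed average of the first `n` sets of a sequence (Minkowski sum, closed, divided
by `n`). -/
noncomputable def closedAverage {E : Type*} [NormedAddCommGroup E] [NormedSpace ℝ E]
    (A : ℕ → Set E) (n : ℕ) : Set E :=
  (n : ℝ)⁻¹ • closure (∑ i ∈ Finset.range n, A i)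

/-! Compactness reduces the theorem to finitely many sets. For `ε > 0` a finite net `A 0, …, A N` of
`Z` and a measurable nearest-index map `q` replace each `X i ω` by `A (q (X i ω))` at Hausdorff cost
`ε`. The scalar strong law gives visit frequencies tending to `p j = P(q ∘ X 0 = j)`. Since the sets
in the net are bounded, the convexified averages are eventually within a multiple of `ε` of `∑ p j •
co (A j)`.

This sum is also close to `C`. The mean of a selector over a fibre of `q ∘ X 0` lies near `co (A j)`
(`exists_dist_integral_sum_le`). Conversely, points `a j ∈ A j` are followed by a measurable
selector (`BddClosed.exists_selector`), so `∑ p j • A j` is near `C`; convexity of `C` and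
`convexHull_sum` extend this to the hulls.

Without hulls, a point of `co (A j)` is recovered by repeating points of `A j` in suitable
proportions (`exists_norm_sum_sub_card_smul_le`). The error in the sum is bounded and vanishes after
division by `n`, but the bound depends on the point: hence Fisher convergence only. -/

/-! ### Finite measurable nets and countably-valued maps -/

section Quantization

/-- A compact set of a metric space is mapped measurably to a finite `ε`-net of it. -/
theorem IsCompact.exists_measurable_quantization {α : Type*} [PseudoMetricSpace α]
    [MeasurableSpace α] [OpensMeasurableSpace α] {Z : Set α} (hZ : IsCompact Z)
    (hne : Z.Nonempty) {ε : ℝ} (hε : 0 < ε) :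
    ∃ (N : ℕ) (q : α → ℕ) (A : ℕ → α), Measurable q ∧ (∀ z, q z ≤ N) ∧
      ∀ z ∈ Z, dist z (A (q z)) ≤ ε := by
  classical
  obtain ⟨d, -⟩ := hne
  obtain ⟨t, -, htf, ht⟩ := hZ.finite_cover_balls hε
  let l := htf.toFinset.toList
  -- `nearestPtInd` may return the index `l.length`, one past the list; the default `d` fills it.
  let e : ℕ → α := fun k => l.getD k d
  refine ⟨l.length, SimpleFunc.nearestPtInd e l.length, e, SimpleFunc.measurable _,
    SimpleFunc.nearestPtInd_le e _, fun z hz => ?_⟩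
  obtain ⟨x, hx, hzx⟩ := Set.mem_iUnion₂.1 (ht hz)
  obtain ⟨k, hk, rfl⟩ := List.mem_iff_getElem.1
    (Finset.mem_toList.2 (htf.mem_toFinset.2 hx) : x ∈ l)
  have h := SimpleFunc.edist_nearestPt_le e z hk.le
  have he : e k = l[k] := List.getD_eq_getElem _ _ hk
  rw [he, edist_dist, edist_dist, ENNReal.ofReal_le_ofReal_iff dist_nonneg] at h
  rw [dist_comm]
  refine le_trans h ?_
  rw [dist_comm]
  exact (Metric.mem_ball.1 hzx).le

theorem IsCountablyValued.of_comp {Ω α : Type*} [MeasurableSpace Ω] (a : ℕ → α) {c : Ω → ℕ}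
    (hc : Measurable c) : IsCountablyValued fun ω => a (c ω) := by
  refine ⟨a, fun i => c ⁻¹' {i}, fun i => hc (measurableSet_singleton i), fun i j hij => ?_, ?_,
    fun i ω hω => congrArg a hω⟩
  · exact Disjoint.preimage c (by simpa using hij)
  · exact Set.eq_univ_of_forall fun ω => Set.mem_iUnion.2 ⟨c ω, rfl⟩

theorem IsCountablyValued.aestronglyMeasurable {Ω α : Type*} [MeasurableSpace Ω]
    [TopologicalSpace α] [TopologicalSpace.PseudoMetrizableSpace α] {P : Measure Ω} {G : Ω → α}
    (hG : IsCountablyValued G) : AEStronglyMeasurable G P := by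
  obtain ⟨a, s, hs, -, hU, hGa⟩ := hG
  have : AEStronglyMeasurable G (P.restrict (⋃ i, s i)) := by
    rw [aestronglyMeasurable_iUnion_iff]
    intro i
    refine (aestronglyMeasurable_const (b := a i)).congr ?_
    filter_upwards [ae_restrict_mem (hs i)] with ω hω using (hGa i ω hω).symm
  simpa [hU] using this

theorem IsStronglyMeas.aestronglyMeasurable {Ω α : Type*} [MeasurableSpace Ω]
    [PseudoMetricSpace α] {P : Measure Ω} {F : Ω → α}
    (hF : IsStronglyMeas P F) : AEStronglyMeasurable F P := by
  obtain ⟨G, hG, hlim⟩ := hF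
  refine aestronglyMeasurable_of_tendsto_ae atTop (fun n => (hG n).aestronglyMeasurable) ?_
  have h : ∀ᵐ ω ∂P, ∀ n, edist (G n ω) (F ω) ≤ essSup (fun ω => edist (G n ω) (F ω)) P :=
    ae_all_iff.2 fun n => ae_le_essSup
  filter_upwards [h] with ω hω
  rw [tendsto_iff_edist_tendsto_0]
  exact tendsto_of_tendsto_of_tendsto_of_le_of_le tendsto_const_nhds hlim (fun _ => zero_le)
    hω

end Quantization

/-! ### Selectors on a compact family of closed sets -/

section Selectors

variable {E : Type*} [NormedAddCommGroup E]

namespace BddClosed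

theorem mem_cthickening {A B : BddClosed E} {ε : ℝ} (h : dist A B ≤ ε) {x : E}
    (hx : x ∈ (A : Set E)) : x ∈ Metric.cthickening ε (B : Set E) := by
  refine (Metric.infEDist_le_hausdorffEDist_of_mem hx).trans ?_
  rw [← ENNReal.ofReal_toReal (hausdorffEDist_ne_top A B)]
  exact ENNReal.ofReal_le_ofReal h

theorem exists_almost_projection {δ : ℝ} (hδ : 0 < δ) :
    ∃ φ : E → BddClosed E → E, (∀ y (B : BddClosed E), φ y B ∈ (B : Set E)) ∧
      ∀ y (B : BddClosed E), dist y (φ y B) ≤ Metric.infDist y (B : Set E) + δ := by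
  have h : ∀ (y : E) (B : BddClosed E), ∃ x ∈ (B : Set E),
      dist y x < Metric.infDist y (B : Set E) + δ := fun y B =>
    (Metric.infDist_lt_iff B.nonempty).1 (by linarith)
  choose φ h1 h2 using h
  exact ⟨φ, h1, fun y B => (h2 y B).le⟩

/-- On a compact set of sets, any selector of a quantization is close to a selector which is a
uniform limit of countably-valued maps. -/
theorem exists_selector [CompleteSpace E] {Z : Set (BddClosed E)} (hZ : IsCompact Z) {ε : ℝ}
    (hε : 0 < ε) {q : BddClosed E → ℕ} (hq : Measurable q) {A : ℕ → BddClosed E}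
    (hqA : ∀ z ∈ Z, dist z (A (q z)) ≤ ε) {a : ℕ → E} (ha : ∀ j, a j ∈ (A j : Set E)) :
    ∃ (σ : BddClosed E → E) (b : ℕ → ℕ → E) (c : ℕ → BddClosed E → ℕ),
      (∀ z ∈ Z, σ z ∈ (z : Set E)) ∧ (∀ k, Measurable (c k)) ∧
      (∀ k, ∀ z ∈ Z, dist (b k (c k z)) (σ z) ≤ 6 * ε / 2 ^ k) ∧
      ∀ z ∈ Z, dist (a (q z)) (σ z) ≤ 6 * ε := by
  rcases Z.eq_empty_or_nonempty with rfl | hne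
  · exact ⟨fun _ => 0, fun _ _ => 0, fun _ => q, by simp, fun _ => hq, by simp, by simp⟩
  have hpos : ∀ k : ℕ, 0 < ε / 2 ^ k := fun k => by positivity
  choose N' q' A' hq' _ hqA' using fun k : ℕ =>
    hZ.exists_measurable_quantization hne (hpos (k + 1))
  choose φ hφ hφd using fun k : ℕ => exists_almost_projection (E := E) (hpos k)
  -- Almost project successively onto finer net approximations of `z`. The step is at most `ε/2^k +
  -- ε/2^(k+1)`, from passing through `z`, plus the slack `ε/2^k`. This is below `3ε/2^k`, so the
  -- steps sum to at most `6ε`.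
  let y : BddClosed E → ℕ → E := fun z k =>
    Nat.rec (a (q z)) (fun k y => φ k y (A' k (q' k z))) k
  have hy0 : ∀ z, y z 0 = a (q z) := fun z => rfl
  have hyS : ∀ z k, y z (k + 1) = φ k (y z k) (A' k (q' k z)) := fun z k => rfl
  have hnear : ∀ z ∈ Z, ∀ k, ∃ B : BddClosed E, y z k ∈ (B : Set E) ∧ dist z B ≤ ε / 2 ^ k := by
    intro z hz k
    cases k with
    | zero => exact ⟨A (q z), ha _, by simpa using hqA z hz⟩
    | succ k => exact ⟨A' k (q' k z), hφ _ _ _, hqA' k z hz⟩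
  have hstep : ∀ z ∈ Z, ∀ k, dist (y z k) (y z (k + 1)) ≤ 6 * ε / 2 / 2 ^ k := by
    intro z hz k
    obtain ⟨B, hyB, hB⟩ := hnear z hz k
    have h1 : Metric.infDist (y z k) (A' k (q' k z) : Set E) ≤ dist B (A' k (q' k z)) :=
      Metric.infDist_le_hausdorffDist_of_mem hyB (hausdorffEDist_ne_top _ _)
    have h2 := hφd k (y z k) (A' k (q' k z))
    have h3 := dist_triangle_left B (A' k (q' k z)) z
    have h4 := hqA' k z hz
    have h5 : ε / 2 ^ (k + 1) ≤ ε / 2 ^ k := by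
      rw [pow_succ]
      gcongr
      linarith [pow_pos (two_pos (α := ℝ)) k]
    rw [hyS]
    calc _ ≤ 3 * (ε / 2 ^ k) := by linarith
      _ = _ := by ring
  have hlim : ∀ z, ∃ x, z ∈ Z → Tendsto (y z) atTop (𝓝 x) := by
    intro z
    by_cases hz : z ∈ Z
    · obtain ⟨x, hx⟩ := cauchySeq_tendsto_of_complete
        (cauchySeq_of_le_geometric_two (hstep z hz))
      exact ⟨x, fun _ => hx⟩
    · exact ⟨0, fun h => absurd h hz⟩
  choose σ hσ using hlim
  -- Each `y z k` depends on `z` only through finitely many indices, packed into one natural number;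
  -- thus `φ` need not be measurable.
  have hcode : ∀ k, ∃ (b : ℕ → E) (c : BddClosed E → ℕ), Measurable c ∧
      ∀ z, y z k = b (c z) := by
    intro k
    induction k with
    | zero => exact ⟨a, q, hq, fun z => rfl⟩
    | succ k ih =>
      obtain ⟨b, c, hc, hbc⟩ := ih
      refine ⟨fun n => φ k (b n.unpair.1) (A' k n.unpair.2), fun z => Nat.pair (c z) (q' k z),
        (Measurable.of_discrete (f := fun p : ℕ × ℕ => Nat.pair p.1 p.2)).comp
          (hc.prodMk (hq' k)), fun z => ?_⟩
      simp [hyS, hbc]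
  choose b c hc hbc using hcode
  refine ⟨σ, b, c, fun z hz => ?_, hc, fun k z hz => ?_, fun z hz => ?_⟩
  · rw [← z.isClosed.closure_eq, Metric.mem_closure_iff_infDist_zero z.nonempty]
    refine le_antisymm ?_ Metric.infDist_nonneg
    have ht : Tendsto (fun k : ℕ => ε / 2 ^ k) atTop (𝓝 0) :=
      tendsto_const_nhds.div_atTop (tendsto_pow_atTop_atTop_of_one_lt one_lt_two)
    refine le_of_tendsto_of_tendsto
      ((Metric.continuous_infDist_pt (z : Set E)).continuousAt.tendsto.comp (hσ z hz)) ht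
      (Eventually.of_forall fun k => ?_)
    obtain ⟨B, hyB, hB⟩ := hnear z hz k
    rw [dist_comm] at hB
    exact (Metric.infDist_le_hausdorffDist_of_mem hyB (hausdorffEDist_ne_top _ _)).trans hB
  · rw [← hbc]
    exact dist_le_of_le_geometric_two_of_tendsto (hstep z hz) (hσ z hz) k
  · rw [← hy0]
    exact dist_le_of_le_geometric_two_of_tendsto₀ (hstep z hz) (hσ z hz)

theorem exists_mem_measurableSelectors [CompleteSpace E] {Ω : Type*} [MeasurableSpace Ω]
    (P : Measure Ω) {X : Ω → BddClosed E} (hX : Measurable X) {Z : Set (BddClosed E)}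
    (hZ : IsCompact Z) (hXZ : ∀ ω, X ω ∈ Z) {ε : ℝ}
    (hε : 0 < ε) {q : BddClosed E → ℕ} (hq : Measurable q) {A : ℕ → BddClosed E}
    (hqA : ∀ z ∈ Z, dist z (A (q z)) ≤ ε) {a : ℕ → E} (ha : ∀ j, a j ∈ (A j : Set E)) :
    ∃ f ∈ measurableSelectors P X, ∀ ω, dist (a (q (X ω))) (f ω) ≤ 6 * ε := by
  obtain ⟨σ, b, c, hσ, hc, hbc, haσ⟩ := exists_selector hZ hε hq hqA ha
  refine ⟨fun ω => σ (X ω), ⟨⟨fun k ω => b k (c k (X ω)),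
    fun k => IsCountablyValued.of_comp (b k) ((hc k).comp hX), ?_⟩, fun ω => hσ _ (hXZ ω)⟩,
    fun ω => haσ _ (hXZ ω)⟩
  have ht : Tendsto (fun k : ℕ => ENNReal.ofReal (6 * ε / 2 ^ k)) atTop (𝓝 0) := by
    rw [← ENNReal.ofReal_zero]
    exact ENNReal.tendsto_ofReal
      (tendsto_const_nhds.div_atTop (tendsto_pow_atTop_atTop_of_one_lt one_lt_two))
  refine tendsto_of_tendsto_of_tendsto_of_le_of_le tendsto_const_nhds ht (fun _ => zero_le)
    fun k => essSup_le_of_ae_le _ (Eventually.of_forall fun ω => ?_)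
  exact (edist_dist _ _).trans_le <| ENNReal.ofReal_le_ofReal (hbc k _ (hXZ ω))

end BddClosed

end Selectors

/-- Points of the convex hull of `A` are averages of points of `A`, up to an error in the sum
that is bounded independently of the number of summands. -/
theorem exists_norm_sum_sub_card_smul_le {E : Type*} [NormedAddCommGroup E] [NormedSpace ℝ E]
    {A : Set E} {x : E} (hx : x ∈ convexHull ℝ A) :
    ∃ K : ℝ, ∀ s : Finset ℕ, ∃ g : ℕ → E, (∀ i ∈ s, g i ∈ A) ∧
      ‖∑ i ∈ s, g i - (s.card : ℝ) • x‖ ≤ K := by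
  classical
  refine convexHull_min (t := {x | ∃ K : ℝ, ∀ s : Finset ℕ, ∃ g : ℕ → E, (∀ i ∈ s, g i ∈ A) ∧
      ‖∑ i ∈ s, g i - (s.card : ℝ) • x‖ ≤ K}) ?_ ?_ hx
  · intro x hx
    refine ⟨0, fun s => ⟨fun _ => x, fun _ _ => hx, ?_⟩⟩
    simp [← Nat.cast_smul_eq_nsmul ℝ]
  · rintro x ⟨K, hK⟩ y ⟨L, hL⟩ α β hα hβ hαβ
    refine ⟨K + L + (‖x‖ + ‖y‖), fun s => ?_⟩
    -- Spend a share `α` of the indices on `x` and the rest on `y`. Rounding shifts the split by at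
    -- most one index, at cost `‖x‖ + ‖y‖`. Arbitrary finite sets of indices let both bounds apply
    -- to the two pieces.
    have hle : ⌊α * s.card⌋₊ ≤ s.card := by
      refine Nat.floor_le_of_le ?_
      exact mul_le_of_le_one_left (Nat.cast_nonneg _) (by linarith)
    obtain ⟨t, hts, ht⟩ := Finset.exists_subset_card_eq hle
    obtain ⟨g, hg, hgK⟩ := hK t
    obtain ⟨g', hg', hgL⟩ := hL (s \ t)
    refine ⟨fun i => if i ∈ t then g i else g' i, fun i hi => ?_, ?_⟩
    · by_cases hit : i ∈ t
      · simpa [hit] using hg i hit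
      · simpa [hit] using hg' i (Finset.mem_sdiff.2 ⟨hi, hit⟩)
    have hsum : ∑ i ∈ s, (if i ∈ t then g i else g' i) =
        ∑ i ∈ t, g i + ∑ i ∈ s \ t, g' i := by
      rw [← Finset.sum_sdiff hts, add_comm]
      congr 1
      · exact Finset.sum_congr rfl fun i hi => if_pos hi
      · exact Finset.sum_congr rfl fun i hi => if_neg (Finset.mem_sdiff.1 hi).2
    have hcard : ((s \ t).card : ℝ) = s.card - t.card := by
      rw [Finset.card_sdiff_of_subset hts, Nat.cast_sub (Finset.card_le_card hts)]
    set δ : ℝ := t.card - α * s.card with hδ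
    have hδ1 : |δ| ≤ 1 := by
      have h1 := Nat.floor_le (a := α * s.card) (by positivity)
      have h2 := Nat.lt_floor_add_one (α * s.card)
      rw [← ht] at h1 h2
      rw [abs_le]
      constructor <;> linarith
    have hid : ∑ i ∈ t, g i + ∑ i ∈ s \ t, g' i - (s.card : ℝ) • (α • x + β • y) =
        (∑ i ∈ t, g i - (t.card : ℝ) • x) + (∑ i ∈ s \ t, g' i - ((s \ t).card : ℝ) • y) +
          (δ • x - δ • y) := by
      rw [hcard, hδ, eq_sub_of_add_eq' hαβ]
      module
    rw [hsum, hid]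
    refine (norm_add₃_le).trans ?_
    have h3 : ‖δ • x - δ • y‖ ≤ ‖x‖ + ‖y‖ := by
      refine (norm_sub_le _ _).trans ?_
      rw [norm_smul, norm_smul, Real.norm_eq_abs]
      gcongr <;> exact mul_le_of_le_one_left (norm_nonneg _) hδ1
    linarith

/-! ### Closed thickenings -/

section Thickening

variable {E : Type*} [PseudoMetricSpace E]

theorem Metric.mem_cthickening_add_of_dist_le {s : Set E} {x y : E} {a b : ℝ} (ha : 0 ≤ a)
    (hy : y ∈ Metric.cthickening a s) (h : dist x y ≤ b) :
    x ∈ Metric.cthickening (a + b) s := by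
  have hb : 0 ≤ b := dist_nonneg.trans h
  rw [Metric.mem_cthickening_iff] at hy ⊢
  refine (Metric.infEDist_le_edist_add_infEDist (y := y)).trans ?_
  rw [add_comm, ENNReal.ofReal_add ha hb, edist_dist]
  exact add_le_add hy (ENNReal.ofReal_le_ofReal h)

theorem Metric.exists_dist_le_of_mem_cthickening {s : Set E} {x : E} {a b : ℝ} (hb : 0 < b)
    (hab : a < b) (hx : x ∈ Metric.cthickening a s) : ∃ y ∈ s, dist x y ≤ b := by
  obtain ⟨y, hy, h⟩ := Metric.mem_thickening_iff.1
    (Metric.cthickening_subset_thickening' hb hab s hx)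
  exact ⟨y, hy, h.le⟩

end Thickening

/-- The proportion of the first `n` terms of a sequence which are equal to `j`. -/
noncomputable def visitFreq (c : ℕ → ℕ) (n j : ℕ) : ℝ :=
  (((Finset.range n).filter fun i => c i = j).card : ℝ) / n

/-! ### Visit frequencies and integrals over the fibres of a quantization -/

section Probability

variable {Ω : Type*} [MeasurableSpace Ω] {P : Measure Ω}

theorem ae_tendsto_visitFreq [IsProbabilityMeasure P] {α : Type*} [MeasurableSpace α] {X : ℕ → Ω → α}
    (hX : ∀ i, Measurable (X i)) (hindep : iIndepFun X P)
    (hident : ∀ i, IdentDistrib (X i) (X 0) P P) {q : α → ℕ} (hq : Measurable q) :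
    ∀ᵐ ω ∂P, ∀ j, Tendsto (fun n => visitFreq (fun i => q (X i ω)) n j) atTop
      (𝓝 (P.real {ω | q (X 0 ω) = j})) := by
  refine ae_all_iff.2 fun j => ?_
  let φ : α → ℝ := (q ⁻¹' {j}).indicator 1
  have hS : MeasurableSet (q ⁻¹' {j}) := hq (measurableSet_singleton j)
  have hφ : Measurable φ := measurable_one.indicator hS
  have hcomp : φ ∘ X 0 = {ω | q (X 0 ω) = j}.indicator 1 := by
    ext ω
    simp [φ, Set.indicator]
  have hSX : MeasurableSet {ω | q (X 0 ω) = j} := hX 0 hS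
  have h := strong_law_ae_real (μ := P) (fun i => φ ∘ X i)
    (by
      rw [hcomp]
      exact (integrable_const (1 : ℝ)).indicator hSX)
    (fun i k hik => (hindep.indepFun hik).comp hφ hφ) (fun i => (hident i).comp hφ)
  rw [hcomp, integral_indicator_one hSX] at h
  filter_upwards [h] with ω hω
  refine hω.congr fun n => ?_
  simp [visitFreq, φ, Set.indicator, Finset.sum_boole]

variable {E : Type*} [NormedAddCommGroup E] [NormedSpace ℝ E]

theorem integral_eq_sum_setIntegral_fiber {c : Ω → ℕ} (hc : Measurable c) {N : ℕ}
    (hN : ∀ ω, c ω ≤ N) {f : Ω → E} (hf : Integrable f P) :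
    ∫ ω, f ω ∂P = ∑ j ∈ Finset.range (N + 1), ∫ ω in {ω | c ω = j}, f ω ∂P := by
  rw [← integral_biUnion_finset, ← setIntegral_univ]
  · congr 2
    symm
    exact Set.eq_univ_of_forall fun ω => Set.mem_iUnion₂.2
      ⟨c ω, Finset.mem_range.2 (Nat.lt_succ_of_le (hN ω)), rfl⟩
  · exact fun j _ => hc (measurableSet_singleton j)
  · intro i _ j _ hij
    refine Set.disjoint_left.2 fun ω hi hj => hij ?_
    exact (show c ω = i from hi).symm.trans hj
  · exact fun j _ => hf.integrableOn

theorem integral_comp_eq_sum [IsProbabilityMeasure P] {c : Ω → ℕ} (hc : Measurable c) {N : ℕ} (hN : ∀ ω, c ω ≤ N)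
    [CompleteSpace E] (a : ℕ → E) {M : ℝ} (hM : ∀ j ≤ N, ‖a j‖ ≤ M) :
    Integrable (fun ω => a (c ω)) P ∧
    ∫ ω, a (c ω) ∂P = ∑ j ∈ Finset.range (N + 1), P.real {ω | c ω = j} • a j := by
  have hint : Integrable (fun ω => a (c ω)) P :=
    Integrable.of_bound (IsCountablyValued.of_comp a hc).aestronglyMeasurable M
      (Eventually.of_forall fun ω => hM _ (hN ω))
  refine ⟨hint, ?_⟩
  rw [integral_eq_sum_setIntegral_fiber hc hN hint]
  refine Finset.sum_congr rfl fun j _ => ?_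
  have hms : MeasurableSet {ω | c ω = j} := hc (measurableSet_singleton j)
  rw [setIntegral_congr_fun (g := fun _ => a j) hms
    (fun ω hω => congrArg a hω), setIntegral_const]

/-- The mean of `f` over a fibre stays in the closed convex set `cthickening ε (convexHull ℝ (A
j))`. Choosing an actual point of the hull costs the slack from `ε` to `2 * ε`; null fibres accept
any point. -/
theorem exists_dist_integral_sum_le [IsProbabilityMeasure P] [CompleteSpace E] {c : Ω → ℕ}
    (hc : Measurable c) {N : ℕ} (hN : ∀ ω, c ω ≤ N) {A : ℕ → Set E} (hA : ∀ j, (A j).Nonempty) {ε : ℝ} (hε : 0 < ε)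
    {f : Ω → E} (hf : Integrable f P) (hfA : ∀ ω, f ω ∈ Metric.cthickening ε (A (c ω))) :
    ∃ u : ℕ → E, (∀ j, u j ∈ convexHull ℝ (A j)) ∧
      dist (∫ ω, f ω ∂P) (∑ j ∈ Finset.range (N + 1), P.real {ω | c ω = j} • u j)
        ≤ 2 * ε := by
  have hms : ∀ j, MeasurableSet {ω | c ω = j} := fun j => hc (measurableSet_singleton j)
  have h : ∀ j, ∃ u ∈ convexHull ℝ (A j), dist (∫ ω in {ω | c ω = j}, f ω ∂P)
      (P.real {ω | c ω = j} • u) ≤ P.real {ω | c ω = j} * (2 * ε) := by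
    intro j
    by_cases h0 : P {ω | c ω = j} = 0
    · obtain ⟨u, hu⟩ := hA j
      refine ⟨u, subset_convexHull ℝ _ hu, ?_⟩
      simp [Measure.restrict_eq_zero.2 h0, Measure.real, h0]
    · have hmem : ⨍ ω in {ω | c ω = j}, f ω ∂P ∈
          Metric.cthickening ε (convexHull ℝ (A j)) := by
        refine ((convex_convexHull ℝ _).cthickening ε).set_average_mem
          Metric.isClosed_cthickening h0 (measure_ne_top _ _) ?_ hf.integrableOn
        filter_upwards [ae_restrict_mem (hms j)] with ω hω
        have := hfA ω
        rw [show c ω = j from hω] at this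
        exact Metric.cthickening_subset_of_subset ε (subset_convexHull ℝ _) this
      obtain ⟨u, hu, hdist⟩ := Metric.exists_dist_le_of_mem_cthickening
        (b := 2 * ε) (by linarith) (by linarith) hmem
      refine ⟨u, hu, ?_⟩
      rw [← measure_smul_setAverage _ (measure_ne_top _ _), dist_smul₀, Real.norm_eq_abs,
        abs_of_nonneg measureReal_nonneg]
      exact mul_le_mul_of_nonneg_left hdist measureReal_nonneg
  choose u hu hdist using h
  refine ⟨u, hu, ?_⟩
  rw [integral_eq_sum_setIntegral_fiber hc hN hf]
  refine (dist_sum_sum_le_of_le _ fun j _ => hdist j).trans_eq ?_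
  have h1 := (integral_comp_eq_sum (P := P) hc hN (fun _ => (1 : ℝ)) (M := 1) (by simp)).2
  rw [← Finset.sum_mul]
  simp only [integral_const, probReal_univ, smul_eq_mul, mul_one] at h1
  rw [← h1, one_mul]

end Probability

/-! ### Deterministic averages along a sequence with limiting frequencies -/

section Averages

variable {E : Type*} [NormedAddCommGroup E] [NormedSpace ℝ E]

theorem dist_average_le {n : ℕ} (hn : n ≠ 0) {y u : ℕ → E} {r : ℝ}
    (h : ∀ i < n, dist (y i) (u i) ≤ r) :
    dist ((n : ℝ)⁻¹ • ∑ i ∈ Finset.range n, y i) ((n : ℝ)⁻¹ • ∑ i ∈ Finset.range n, u i)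
      ≤ r := by
  have hn' : (0 : ℝ) < n := by positivity
  rw [dist_smul₀, norm_inv, Real.norm_natCast, inv_mul_le_iff₀ hn']
  refine (dist_sum_sum_le_of_le _ fun i hi => h i (Finset.mem_range.1 hi)).trans_eq ?_
  simp

theorem average_comp_eq_sum_visitFreq {c : ℕ → ℕ} {N : ℕ} (hN : ∀ i, c i ≤ N) (v : ℕ → E)
    (n : ℕ) :
    (n : ℝ)⁻¹ • ∑ i ∈ Finset.range n, v (c i) =
      ∑ j ∈ Finset.range (N + 1), visitFreq c n j • v j := by
  rw [← Finset.sum_fiberwise_of_maps_to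
    (fun i _ => Finset.mem_range.2 (Nat.lt_succ_of_le (hN i))), Finset.smul_sum]
  refine Finset.sum_congr rfl fun j _ => ?_
  rw [Finset.sum_congr rfl fun i hi => congrArg v (Finset.mem_filter.1 hi).2, Finset.sum_const,
    ← Nat.cast_smul_eq_nsmul ℝ, smul_smul, visitFreq, div_eq_inv_mul]

/-- Terms with the same index `j` average to one point of the convex set `B j`; an unvisited `j` has
frequency zero. -/
theorem exists_average_eq_sum_visitFreq {c : ℕ → ℕ} {N : ℕ} (hN : ∀ i, c i ≤ N)
    {B : ℕ → Set E} (hB : ∀ j, Convex ℝ (B j)) (hne : ∀ j, (B j).Nonempty) {u : ℕ → E} (n : ℕ)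
    (hu : ∀ i < n, u i ∈ B (c i)) :
    ∃ v : ℕ → E, (∀ j, v j ∈ B j) ∧ (n : ℝ)⁻¹ • ∑ i ∈ Finset.range n, u i =
      ∑ j ∈ Finset.range (N + 1), visitFreq c n j • v j := by
  have h : ∀ j, ∃ v ∈ B j, ∑ i ∈ Finset.range n with c i = j, u i =
      (((Finset.range n).filter fun i => c i = j).card : ℝ) • v := by
    intro j
    set s := (Finset.range n).filter fun i => c i = j with hs
    rcases s.eq_empty_or_nonempty with h0 | h0
    · obtain ⟨v, hv⟩ := hne j
      exact ⟨v, hv, by simp [h0]⟩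
    · have hcard : (s.card : ℝ) ≠ 0 := by simpa using h0.ne_empty
      refine ⟨∑ i ∈ s, (s.card : ℝ)⁻¹ • u i, (hB j).sum_mem (fun _ _ => by positivity)
        (by simp [hcard]) fun i hi => ?_, ?_⟩
      · obtain ⟨h1, h2⟩ := Finset.mem_filter.1 hi
        exact h2 ▸ hu i (Finset.mem_range.1 h1)
      · rw [← Finset.smul_sum, smul_inv_smul₀ hcard]
  choose v hv hsum using h
  refine ⟨v, hv, ?_⟩
  rw [← Finset.sum_fiberwise_of_maps_to
    (fun i _ => Finset.mem_range.2 (Nat.lt_succ_of_le (hN i))), Finset.smul_sum]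
  refine Finset.sum_congr rfl fun j _ => ?_
  rw [hsum, smul_smul, visitFreq, div_eq_inv_mul]

/-- The threshold for `n` does not depend on `v`, which makes the Hausdorff estimates uniform over
the sets. -/
theorem eventually_dist_sum_visitFreq_le {c : ℕ → ℕ} {p : ℕ → ℝ} (N : ℕ)
    (hp : ∀ j, Tendsto (fun n => visitFreq c n j) atTop (𝓝 (p j))) (M : ℝ) {ε : ℝ}
    (hε : 0 < ε) :
    ∀ᶠ n in atTop, ∀ v : ℕ → E, (∀ j ≤ N, ‖v j‖ ≤ M) →
      dist (∑ j ∈ Finset.range (N + 1), visitFreq c n j • v j)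
        (∑ j ∈ Finset.range (N + 1), p j • v j) ≤ ε := by
  have h : Tendsto (fun n => ∑ j ∈ Finset.range (N + 1), |visitFreq c n j - p j| * M) atTop
      (𝓝 0) := by
    have := tendsto_finsetSum (Finset.range (N + 1)) fun j _ =>
      (((hp j).sub_const (p j)).abs.mul_const M)
    simpa using this
  filter_upwards [h.eventually_le_const hε] with n hn v hv
  refine le_trans (dist_sum_sum_le_of_le _ fun j hj => ?_) hn
  rw [dist_eq_norm, ← sub_smul, norm_smul, Real.norm_eq_abs]
  exact mul_le_mul_of_nonneg_left (hv j (Nat.lt_succ_iff.1 (Finset.mem_range.1 hj)))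
    (abs_nonneg _)

theorem smul_sum_mem_closedAverage {A : ℕ → Set E} {n : ℕ} {y : ℕ → E}
    (hy : ∀ i < n, y i ∈ A i) :
    (n : ℝ)⁻¹ • ∑ i ∈ Finset.range n, y i ∈ closedAverage A n :=
  Set.smul_mem_smul_set (subset_closure ((Set.mem_finsetSum _ _ _).2
    ⟨y, fun {i} hi => hy i (Finset.mem_range.1 hi), rfl⟩))

theorem closedAverage_subset {A : ℕ → Set E} {n : ℕ} {B : Set E} (hB : IsClosed B)
    (h : ∀ y : ℕ → E, (∀ i < n, y i ∈ A i) →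
      (n : ℝ)⁻¹ • ∑ i ∈ Finset.range n, y i ∈ B) : closedAverage A n ⊆ B := by
  rintro _ ⟨w, hw, rfl⟩
  have hcl : IsClosed ((fun w : E => (n : ℝ)⁻¹ • w) ⁻¹' B) :=
    hB.preimage (continuous_const_smul _)
  refine closure_minimal (fun w hw => ?_) hcl hw
  obtain ⟨y, hy, rfl⟩ := (Set.mem_finsetSum _ _ _).1 hw
  exact h y fun i hi => hy (Finset.mem_range.2 hi)

theorem closedAverage_mono {A B : ℕ → Set E} (h : ∀ i, A i ⊆ B i) (n : ℕ) :
    closedAverage A n ⊆ closedAverage B n :=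
  Set.smul_set_mono (closure_mono (Set.finsetSum_subset_finsetSum _ _ _ fun i _ => h i))

variable {c : ℕ → ℕ} {N : ℕ} {x A : ℕ → Set E} {C : Set E} {p : ℕ → ℝ} {M ε : ℝ}

theorem eventually_closedAverage_subset_cthickening (hN : ∀ i, c i ≤ N)
    (hA : ∀ j, (A j).Nonempty) (hε : 0 < ε) (hM : ∀ j ≤ N, ∀ y ∈ convexHull ℝ (A j), ‖y‖ ≤ M)
    (hxA : ∀ i, x i ⊆ Metric.cthickening ε (A (c i)))
    (hp : ∀ j, Tendsto (fun n => visitFreq c n j) atTop (𝓝 (p j)))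
    (hC : ∀ v : ℕ → E, (∀ j, v j ∈ convexHull ℝ (A j)) →
      ∑ j ∈ Finset.range (N + 1), p j • v j ∈ Metric.cthickening (6 * ε) C) :
    ∀ᶠ n in atTop, closedAverage (fun i => closedConvexHull ℝ (x i)) n ⊆
      Metric.cthickening (9 * ε) C := by
  filter_upwards [eventually_dist_sum_visitFreq_le (E := E) N hp M hε, eventually_ne_atTop 0]
    with n hn hn0
  refine closedAverage_subset Metric.isClosed_cthickening fun y hy => ?_
  have h : ∀ i, ∃ u, i < n → u ∈ convexHull ℝ (A (c i)) ∧ dist (y i) u ≤ 2 * ε := by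
    intro i
    by_cases hi : i < n
    · have hmem : y i ∈ Metric.cthickening ε (convexHull ℝ (A (c i))) :=
        closedConvexHull_min ((hxA i).trans
          (Metric.cthickening_subset_of_subset ε (subset_convexHull ℝ _)))
          ((convex_convexHull ℝ _).cthickening ε) Metric.isClosed_cthickening (hy i hi)
      obtain ⟨u, hu, hd⟩ := Metric.exists_dist_le_of_mem_cthickening (b := 2 * ε)
        (by linarith) (by linarith) hmem
      exact ⟨u, fun _ => ⟨hu, hd⟩⟩
    · exact ⟨0, fun h => absurd h hi⟩
  choose u hu using h
  obtain ⟨v, hv, hsum⟩ := exists_average_eq_sum_visitFreq hN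
    (B := fun j => convexHull ℝ (A j)) (fun j => convex_convexHull ℝ _)
    (fun j => (hA j).convexHull) n (fun i hi => (hu i hi).1)
  have h1 := dist_average_le hn0 fun i hi => (hu i hi).2
  rw [hsum] at h1
  have h2 := hn v fun j hj => hM j hj _ (hv j)
  have h3 := (dist_triangle _ _ _).trans (add_le_add h1 h2)
  have := Metric.mem_cthickening_add_of_dist_le (by positivity) (hC v hv) h3
  rwa [show 6 * ε + (2 * ε + ε) = 9 * ε by ring] at this

theorem eventually_subset_cthickening_closedAverage (hN : ∀ i, c i ≤ N)
    (hε : 0 < ε) (hM : ∀ j ≤ N, ∀ y ∈ convexHull ℝ (A j), ‖y‖ ≤ M)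
    (hAx : ∀ i, A (c i) ⊆ Metric.cthickening ε (x i))
    (hp : ∀ j, Tendsto (fun n => visitFreq c n j) atTop (𝓝 (p j)))
    (hC : ∀ z ∈ C, ∃ u : ℕ → E, (∀ j, u j ∈ convexHull ℝ (A j)) ∧
      dist z (∑ j ∈ Finset.range (N + 1), p j • u j) ≤ 3 * ε) :
    ∀ᶠ n in atTop, C ⊆ Metric.cthickening (9 * ε)
      (closedAverage (fun i => closedConvexHull ℝ (x i)) n) := by
  filter_upwards [eventually_dist_sum_visitFreq_le (E := E) N hp M hε, eventually_ne_atTop 0]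
    with n hn hn0 z hz
  obtain ⟨u, hu, hzu⟩ := hC z hz
  have h : ∀ i, ∃ y ∈ closedConvexHull ℝ (x i), dist (u (c i)) y ≤ 2 * ε := by
    intro i
    have hmem : u (c i) ∈ Metric.cthickening ε (closedConvexHull ℝ (x i)) :=
      convexHull_min ((hAx i).trans
        (Metric.cthickening_subset_of_subset ε subset_closedConvexHull))
        (convex_closedConvexHull.cthickening ε) (hu (c i))
    exact Metric.exists_dist_le_of_mem_cthickening (by linarith) (by linarith) hmem
  choose y hy hd using h
  have h1 := dist_average_le (n := n) hn0 fun i _ => hd i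
  rw [average_comp_eq_sum_visitFreq hN] at h1
  have h2 := hn u fun j hj => hM j hj _ (hu j)
  rw [dist_comm] at h2
  have h3 := (dist_triangle4 _ _ _ _).trans (add_le_add (add_le_add hzu h2) h1)
  exact Metric.mem_cthickening_of_dist_le _ _ _ _
    (smul_sum_mem_closedAverage fun i _ => hy i) (h3.trans (by linarith))

theorem eventually_mem_cthickening_closedAverage (hN : ∀ i, c i ≤ N)
    (hε : 0 < ε) (hM : ∀ j ≤ N, ∀ y ∈ convexHull ℝ (A j), ‖y‖ ≤ M)
    (hAx : ∀ i, A (c i) ⊆ Metric.cthickening ε (x i))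
    (hp : ∀ j, Tendsto (fun n => visitFreq c n j) atTop (𝓝 (p j))) {z : E}
    (hz : ∃ u : ℕ → E, (∀ j, u j ∈ convexHull ℝ (A j)) ∧
      dist z (∑ j ∈ Finset.range (N + 1), p j • u j) ≤ 3 * ε) :
    ∀ᶠ n in atTop, z ∈ Metric.cthickening (9 * ε) (closedAverage x n) := by
  obtain ⟨u, hu, hzu⟩ := hz
  choose K g hgA hgK using fun j => exists_norm_sum_sub_card_smul_le (hu j)
  have hlim : Tendsto (fun n : ℕ => (∑ j ∈ Finset.range (N + 1), K j) / n) atTop (𝓝 0) :=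
    tendsto_const_nhds.div_atTop tendsto_natCast_atTop_atTop
  filter_upwards [eventually_dist_sum_visitFreq_le (E := E) N hp M hε, eventually_ne_atTop 0,
    hlim.eventually_le_const hε] with n hn hn0 hK
  let s : ℕ → Finset ℕ := fun j => (Finset.range n).filter fun i => c i = j
  -- The approximants for `j` are chosen for the whole set of visits to `j` before time `n`, so
  -- their total error is at most `K j`.
  let w : ℕ → E := fun i => g (c i) (s (c i)) i
  have hw : ∀ i < n, w i ∈ A (c i) := fun i hi =>
    hgA _ _ _ (Finset.mem_filter.2 ⟨Finset.mem_range.2 hi, rfl⟩)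
  have hd : ∀ i, ∃ y, i < n → y ∈ x i ∧ dist (w i) y ≤ 2 * ε := by
    intro i
    by_cases hi : i < n
    · obtain ⟨y, hy, hd⟩ := Metric.exists_dist_le_of_mem_cthickening (b := 2 * ε)
        (by linarith) (by linarith) (hAx i (hw i hi))
      exact ⟨y, fun _ => ⟨hy, hd⟩⟩
    · exact ⟨0, fun h => absurd h hi⟩
  choose y hy using hd
  have h1 := dist_average_le hn0 fun i hi => (hy i hi).2
  have h2 := hn u fun j hj => hM j hj _ (hu j)
  have h3 : dist (∑ j ∈ Finset.range (N + 1), visitFreq c n j • u j)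
      ((n : ℝ)⁻¹ • ∑ i ∈ Finset.range n, w i) ≤ ε := by
    refine le_trans ?_ hK
    rw [← Finset.sum_fiberwise_of_maps_to
      (fun i _ => Finset.mem_range.2 (Nat.lt_succ_of_le (hN i))) w, Finset.smul_sum,
      Finset.sum_div]
    refine dist_sum_sum_le_of_le _ fun j _ => ?_
    have hsum : ∑ i ∈ Finset.range n with c i = j, w i = ∑ i ∈ s j, g j (s j) i :=
      Finset.sum_congr rfl fun i hi => by
        rw [← (Finset.mem_filter.1 hi).2]
    rw [hsum, visitFreq, div_eq_inv_mul, mul_smul, dist_smul₀, norm_inv, Real.norm_natCast,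
      dist_comm, dist_eq_norm, div_eq_inv_mul]
    exact mul_le_mul_of_nonneg_left (hgK j (s j)) (by positivity)
  rw [dist_comm] at h2
  have h4 := (dist_triangle4 _ _ _ _).trans (add_le_add (add_le_add hzu h2) h3)
  have h5 := (dist_triangle _ _ _).trans (add_le_add h4 h1)
  exact Metric.mem_cthickening_of_dist_le _ _ _ _
    (smul_sum_mem_closedAverage fun i hi => (hy i hi).1) (h5.trans (by linarith))

end Averages

/-! ### Comparing the expectation with the quantized Aumann sum -/

section Expectation

variable {E : Type*} [NormedAddCommGroup E] [NormedSpace ℝ E] [CompleteSpace E]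
  {Ω : Type*} [MeasurableSpace Ω] {P : Measure Ω} [IsProbabilityMeasure P]
  {X : Ω → BddClosed E} {Z : Set (BddClosed E)} {ε M : ℝ} {q : BddClosed E → ℕ} {N : ℕ}
  {A : ℕ → BddClosed E}

theorem exists_dist_sum_le_of_mem_setExpectation (hX : Measurable X) (hXZ : ∀ ω, X ω ∈ Z)
    (hε : 0 < ε) (hq : Measurable q) (hN : ∀ z, q z ≤ N)
    (hqA : ∀ z ∈ Z, dist z (A (q z)) ≤ ε) (hM : ∀ j ≤ N, ∀ y ∈ (A j : Set E), ‖y‖ ≤ M)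
    {z : E} (hz : z ∈ setExpectation P X) :
    ∃ u : ℕ → E, (∀ j, u j ∈ convexHull ℝ (A j : Set E)) ∧
      dist z (∑ j ∈ Finset.range (N + 1), P.real {ω | q (X ω) = j} • u j) ≤ 3 * ε := by
  obtain ⟨_, ⟨f, ⟨hfm, hfX⟩, rfl⟩, hzf⟩ := Metric.mem_closure_iff.1 hz ε hε
  have hfA : ∀ ω, f ω ∈ Metric.cthickening ε (A (q (X ω)) : Set E) := fun ω =>
    BddClosed.mem_cthickening (hqA _ (hXZ ω)) (hfX ω)
  have hf : Integrable f P := by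
    refine Integrable.of_bound hfm.aestronglyMeasurable (M + 2 * ε)
      (Eventually.of_forall fun ω => ?_)
    obtain ⟨y, hy, hd⟩ := Metric.exists_dist_le_of_mem_cthickening (b := 2 * ε)
      (by linarith) (by linarith) (hfA ω)
    have h1 := hM _ (hN _) y hy
    have h2 := norm_le_norm_add_norm_sub y (f ω)
    rw [← dist_eq_norm, dist_comm] at h2
    linarith
  obtain ⟨u, hu, hd⟩ := exists_dist_integral_sum_le (hq.comp hX) (fun ω => hN (X ω))
    (fun j => (A j).nonempty) hε hf hfA
  exact ⟨u, hu, (dist_triangle _ _ _).trans ((add_le_add hzf.le hd).trans (by linarith))⟩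

theorem sum_mem_cthickening_setExpectation (hX : Measurable X) (hZ : IsCompact Z)
    (hXZ : ∀ ω, X ω ∈ Z) (hε : 0 < ε) (hq : Measurable q) (hN : ∀ z, q z ≤ N)
    (hqA : ∀ z ∈ Z, dist z (A (q z)) ≤ ε) (hM : ∀ j ≤ N, ∀ y ∈ (A j : Set E), ‖y‖ ≤ M)
    (hconv : Convex ℝ (setExpectation P X)) {v : ℕ → E}
    (hv : ∀ j, v j ∈ convexHull ℝ (A j : Set E)) :
    ∑ j ∈ Finset.range (N + 1), P.real {ω | q (X ω) = j} • v j ∈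
      Metric.cthickening (6 * ε) (setExpectation P X) := by
  -- It suffices to treat `∑ p j • A j`: the hull of this sum is the sum of the hulls, and the
  -- thickened expectation is convex.
  set p : ℕ → ℝ := fun j => P.real {ω | q (X ω) = j}
  have hsub : ∑ j ∈ Finset.range (N + 1), p j • (A j : Set E) ⊆
      Metric.cthickening (6 * ε) (setExpectation P X) := by
    intro w hw
    obtain ⟨g, hg, rfl⟩ := (Set.mem_finsetSum _ _ _).1 hw
    have h : ∀ j, ∃ a ∈ (A j : Set E), j ∈ Finset.range (N + 1) → p j • a = g j := by
      intro j
      by_cases hj : j ∈ Finset.range (N + 1)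
      · obtain ⟨a, ha, hag⟩ := hg hj
        exact ⟨a, ha, fun _ => hag⟩
      · exact ⟨_, (A j).nonempty.choose_spec, fun h => absurd h hj⟩
    choose a ha hag using h
    rw [← Finset.sum_congr rfl hag]
    obtain ⟨f, hf, hd⟩ := BddClosed.exists_mem_measurableSelectors P hX hZ hXZ hε hq hqA ha
    obtain ⟨hint, hsum⟩ := integral_comp_eq_sum (P := P) (hq.comp hX) (fun ω => hN (X ω)) a
      (fun j hj => hM j hj _ (ha j))
    have hfint : Integrable f P := by
      refine Integrable.of_bound hf.1.aestronglyMeasurable (M + 6 * ε)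
        (Eventually.of_forall fun ω => ?_)
      have h1 := hM _ (hN (X ω)) _ (ha (q (X ω)))
      have h2 := norm_le_norm_add_norm_sub (a (q (X ω))) (f ω)
      rw [← dist_eq_norm] at h2
      linarith [hd ω]
    refine Metric.mem_cthickening_of_dist_le _ (∫ ω, f ω ∂P) _ _
      (subset_closure ⟨f, hf, rfl⟩) ?_
    change dist (∑ j ∈ Finset.range (N + 1), P.real {ω | (q ∘ X) ω = j} • a j) _ ≤ _
    rw [← hsum, dist_eq_norm, ← integral_sub hint hfint]
    refine (norm_integral_le_of_norm_le_const (C := 6 * ε)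
      (Eventually.of_forall fun ω => ?_)).trans_eq (by simp)
    rw [← dist_eq_norm]
    exact hd ω
  refine convexHull_min hsub (hconv.cthickening _) ?_
  rw [convexHull_sum]
  refine (Set.mem_finsetSum _ _ _).2 ⟨fun j => p j • v j, fun {j} _ => ?_, rfl⟩
  rw [convexHull_smul]
  exact Set.smul_mem_smul_set (hv j)

end Expectation

/-! ### Conclusion along `ε = 1 / (k + 1)` -/

theorem ENNReal.tendsto_zero_of_forall_eventually_le {f : ℕ → ℝ≥0∞} {K : ℝ}
    (h : ∀ k : ℕ, ∀ᶠ n in atTop, f n ≤ ENNReal.ofReal (K * (1 / ((k : ℝ) + 1)))) :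
    Tendsto f atTop (𝓝 0) := by
  have ht : Tendsto (fun k : ℕ => ENNReal.ofReal (K * (1 / ((k : ℝ) + 1)))) atTop (𝓝 0) := by
    have := ENNReal.tendsto_ofReal
      ((tendsto_one_div_add_atTop_nhds_zero_nat (𝕜 := ℝ)).const_mul K)
    simpa using this
  refine ENNReal.tendsto_nhds_zero.2 fun δ hδ => ?_
  obtain ⟨k, hk⟩ := (ENNReal.tendsto_nhds_zero.1 ht δ hδ).exists
  exact (h k).mono fun n hn => hn.trans hk

theorem mainTheorem8 {E : Type*} [NormedAddCommGroup E] [NormedSpace ℝ E] [CompleteSpace E]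
    {Ω : Type*} [MeasurableSpace Ω] (P : Measure Ω) [IsProbabilityMeasure P] [P.IsComplete]
    (hP : IsAtomlessMeasure P)
    (Z : Set (BddClosed E)) (hZ : IsCompact Z)
    (X : ℕ → Ω → BddClosed E)
    (hXrandom : ∀ n, IsRandomSet P (X n))
    (hXZ : ∀ n ω, X n ω ∈ Z)
    (hXindep : iIndepFun X P)
    (hXident : ∀ m n, IdentDistrib (X m) (X n) P P)
    (C : BddClosed E) (hCconvex : Convex ℝ (C : Set E))
    (hXC : ∀ n, setExpectation P (X n) = (C : Set E)) :
    (∀ᵐ ω ∂P, TendstoHausdorff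
      (closedAverage fun i => closedConvexHull ℝ (X i ω : Set E)) (C : Set E)) ∧
    (∀ᵐ ω ∂P, TendstoFisher (closedAverage fun i => (X i ω : Set E)) (C : Set E)) := by
  -- `IdentDistrib` carries a.e. measurability, which completeness of `P` upgrades to measurability.
  have hX : ∀ n, Measurable (X n) := fun n =>
    (hXident n n).aemeasurable_fst.nullMeasurable.measurable_of_complete
  have hne : Z.Nonempty := by
    obtain ⟨ω⟩ : Nonempty Ω := P.nonempty_of_neZero
    exact ⟨_, hXZ 0 ω⟩
  -- The exceptional null set comes only from the visit frequencies, so it serves all `z ∈ C` at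
  -- once; countably many `k` keep the union null.
  have key : ∀ k : ℕ, ∀ᵐ ω ∂P,
      (∀ᶠ n in atTop, Metric.hausdorffEDist
        (closedAverage (fun i => closedConvexHull ℝ (X i ω : Set E)) n) (C : Set E) ≤
          ENNReal.ofReal (9 * (1 / ((k : ℝ) + 1)))) ∧
      ∀ z ∈ (C : Set E), ∀ᶠ n in atTop,
        Metric.infEDist z (closedAverage (fun i => (X i ω : Set E)) n) ≤
          ENNReal.ofReal (9 * (1 / ((k : ℝ) + 1))) := by
    intro k
    have hε : 0 < 1 / ((k : ℝ) + 1) := by positivity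
    set ε := 1 / ((k : ℝ) + 1)
    obtain ⟨N, q, A, hq, hN, hqA⟩ := hZ.exists_measurable_quantization hne hε
    obtain ⟨M, hM⟩ : ∃ M, ∀ j ≤ N, ∀ y ∈ (A j : Set E), ‖y‖ ≤ M := by
      obtain ⟨M, hM⟩ := ((Bornology.isBounded_biUnion_finset (Finset.range (N + 1))).2
        fun j _ => (A j).isBounded).exists_norm_le
      exact ⟨M, fun j hj y hy => hM y
        (Set.mem_iUnion₂.2 ⟨j, Finset.mem_range.2 (Nat.lt_succ_of_le hj), hy⟩)⟩
    have hMco : ∀ j ≤ N, ∀ y ∈ convexHull ℝ (A j : Set E), ‖y‖ ≤ M := fun j hj y hy =>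
      mem_closedBall_zero_iff.1 (convexHull_min (fun y hy => mem_closedBall_zero_iff.2
        (hM j hj y hy)) (convex_closedBall 0 M) hy)
    have hlow : ∀ z ∈ (C : Set E), ∃ u : ℕ → E, (∀ j, u j ∈ convexHull ℝ (A j : Set E)) ∧
        dist z (∑ j ∈ Finset.range (N + 1), P.real {ω | q (X 0 ω) = j} • u j) ≤ 3 * ε :=
      fun z hz => exists_dist_sum_le_of_mem_setExpectation (hX 0) (hXZ 0) hε hq hN hqA hM
        (by rwa [hXC])
    have hupp : ∀ v : ℕ → E, (∀ j, v j ∈ convexHull ℝ (A j : Set E)) →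
        ∑ j ∈ Finset.range (N + 1), P.real {ω | q (X 0 ω) = j} • v j ∈
          Metric.cthickening (6 * ε) (C : Set E) := fun v hv => by
      rw [← hXC 0]
      exact sum_mem_cthickening_setExpectation (hX 0) hZ (hXZ 0) hε hq hN hqA hM
        (by rwa [hXC]) hv
    filter_upwards [ae_tendsto_visitFreq hX hXindep (fun i => hXident i 0) hq] with ω hω
    have hxA : ∀ i, (X i ω : Set E) ⊆ Metric.cthickening ε (A (q (X i ω)) : Set E) :=
      fun i y hy => BddClosed.mem_cthickening (hqA _ (hXZ i ω)) hy
    have hAx : ∀ i, (A (q (X i ω)) : Set E) ⊆ Metric.cthickening ε (X i ω : Set E) :=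
      fun i y hy => BddClosed.mem_cthickening (by rw [dist_comm]; exact hqA _ (hXZ i ω)) hy
    refine ⟨?_, fun z hz => ?_⟩
    · filter_upwards [eventually_closedAverage_subset_cthickening
          (A := fun j => (A j : Set E)) (fun i => hN (X i ω)) (fun j => (A j).nonempty) hε hMco
          hxA hω hupp,
        eventually_subset_cthickening_closedAverage (A := fun j => (A j : Set E))
          (fun i => hN (X i ω)) hε hMco hAx hω hlow] with n h1 h2
      exact Metric.hausdorffEDist_le_of_infEDist h1 h2
    · exact eventually_mem_cthickening_closedAverage (A := fun j => (A j : Set E))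
        (fun i => hN (X i ω)) hε hMco hAx hω (hlow z hz)
  have hhaus : ∀ᵐ ω ∂P, TendstoHausdorff
      (closedAverage fun i => closedConvexHull ℝ (X i ω : Set E)) (C : Set E) := by
    filter_upwards [ae_all_iff.2 key] with ω hω
    exact ENNReal.tendsto_zero_of_forall_eventually_le fun k => (hω k).1
  refine ⟨hhaus, ?_⟩
  filter_upwards [ae_all_iff.2 key, hhaus] with ω hω hh
  -- The excess needs no new estimate: the averages lie inside the convexified ones.
  refine ⟨tendsto_of_tendsto_of_tendsto_of_le_of_le tendsto_const_nhds hh (fun _ => zero_le)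
    fun n => iSup₂_le fun y hy => ?_, fun z hz =>
      ENNReal.tendsto_zero_of_forall_eventually_le fun k => (hω k).2 z hz⟩
  exact Metric.infEDist_le_hausdorffEDist_of_mem
    (closedAverage_mono (fun i => subset_closedConvexHull) n hy)
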